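/- In decentralized online convex optimization (D-OCO), $n$ learners are the vertices of an undirected graph $\mathcal G=([n],E)$, and a matrix $P\in\mathbb R^{n\times n}$ is given. In each round $t=1,\dots,T$ every learner $i$ chooses $\mathbf x_i(t)$ in a convex set $\mathcal K\subseteq\mathbb R^d$ and then receives a convex loss $f_{t,i}:\mathcal K\to\mathbb R$; in a communication round it may afterwards exchange information with its immediate neighbours in $\mathcal G$, for instance by one gossip step (averaging with the weights $P_{ij}$). Write $f_t=\sum_{j=1}^n f_{t,j}$ and let $$R_{T,i}=\sum_{t=1}^T f_t(\mathbf x_i(t))-\min_{\mathbf x\in\mathcal K}\sum_{t=1}^T f_t(\mathbf x)$$ be the regret of learner $i$. Call $P$ admissible for $\mathcal G$ if $P_{ij}>0$ only when $(i,j)\in E$ or $i=j$, $P$ is symmetric, doubly stochastic and positive semidefinite, and its second largest singular value $\sigma_2(P)$ is strictly smaller than $1$. **Theorem.** Let $d\ge 1$, $R,G\ge 0$, $\mathcal K=[-R/\sqrt d,R/\sqrt d]^d$, and $n=2(m+1)$ for a positive integer $m$. For any (deterministic) D-OCO algorithm that communicates in $C$ rounds, all before round $T$, where the set of communication rounds does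 not depend on the losses, there exist linear loss functions $f_{t,i}$ that are $G$-Lipschitz over $\mathcal K$ with respect to $\|\cdot\|_2$, a graph $\mathcal G$ (namely the 1-connected cycle on $n$ vertices) and a matrix $P$ admissible for $\mathcal G$ such that $$R_{T,1}\ \ge\ \frac{n\sqrt{\pi}\,RGT}{16\,(1-\sigma_2(P))^{1/4}\sqrt{C+1}}\quad\text{if } n\le 8C+16,\qquad\text{and}\qquad R_{T,1}\ \ge\ \frac{nRGT}{4}\quad\text{otherwise.}$$ Moreover, with $\rho=1-\sigma_2(P)$ these losses and this $P$ satisfy, whatever the number $C$ of communication rounds is, $$R_{T,1}\ \ge\ \frac{\sqrt\pi}{16}\,n\,\rho^{-1/4}\,RG\sqrt T\qquad\text{whenever } n\le 8T,$$ which is an $\Omega(n\rho^{-1/4}\sqrt T)$ lower bound for convex losses. -/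

import Mathlib

universe u v

/-- The cube `[-R/√d, R/√d]^d` in Euclidean space `ℝ^d`. -/
def cube (d : ℕ) (R : ℝ) : Set (EuclideanSpace ℝ (Fin d)) :=
  {x | ∀ k, x k ∈ Set.Icc (-(R / √(d : ℝ))) (R / √(d : ℝ))}

/-- The second largest singular value of a square real matrix (with respect to the Euclidean inner
product, counted with multiplicity; Mathlib numbers the singular values from `0`, in decreasing
order). -/
noncomputable def sigmaTwo {n : ℕ} (P : Matrix (Fin n) (Fin n) ℝ) : ℝ :=
  (Matrix.toEuclideanLin P).singularValues 1

/-- Admissible communication matrices for the graph `Γ`: supported on `Γ`, symmetric, doubly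
stochastic, positive semidefinite, with second largest singular value strictly below `1`. -/
structure IsCommunicationMatrix {n : ℕ} (Γ : SimpleGraph (Fin n))
    (P : Matrix (Fin n) (Fin n) ℝ) : Prop where
  supported : ∀ i j, 0 < P i j → Γ.Adj i j ∨ i = j
  symmetric : P.IsSymm
  nonneg : ∀ i j, 0 ≤ P i j
  row_sum : ∀ i, ∑ j, P i j = 1
  col_sum : ∀ j, ∑ i, P i j = 1
  posSemidef : P.PosSemidef
  sigmaTwo_lt_one : sigmaTwo P < 1

/-- A deterministic algorithm for decentralized online convex optimization with `n` learners,
decision set `K ⊆ ℝ^d`, horizon `T`, which communicates in exactly `C` rounds, all before round `T`.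

The network (the graph and the communication matrix) is given beforehand and may be used in any way,
including in the choice of the communication rounds. In round `t = 1, …, T`, learner `i` plays a
point of `K` that depends on its own memory only, then observes its own local loss function, and, if
`t` is a communication round, sends one message to each neighbour and receives theirs. Memories and
messages are arbitrary, so that a gossip step, in which a learner replaces its vector by the average
of its neighbours' vectors and its own with the weights `P i j`, is a special case. -/
structure DOCOAlgorithm (n d : ℕ) (K : Set (EuclideanSpace ℝ (Fin d))) (T C : ℕ) where
  /-- memory states of a learner -/
  State : Type u
  /-- messages between neighbours -/
  Msg : Type v
  /-- the communication rounds, for a given network -/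
  commRounds : SimpleGraph (Fin n) → Matrix (Fin n) (Fin n) ℝ → Finset ℕ
  commRounds_subset : ∀ Γ P, commRounds Γ P ⊆ Finset.Ico 1 T
  card_commRounds : ∀ Γ P, (commRounds Γ P).card = C
  /-- the initial memory of each learner, for a given network -/
  init : SimpleGraph (Fin n) → Matrix (Fin n) (Fin n) ℝ → Fin n → State
  /-- the decision of learner `i` in round `t` -/
  decide : ℕ → Fin n → State → EuclideanSpace ℝ (Fin d)
  decide_mem : ∀ t i s, decide t i s ∈ K
  /-- the memory of learner `i` after it has observed its loss function of round `t` -/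
  observe : ℕ → Fin n → State → (EuclideanSpace ℝ (Fin d) → ℝ) → State
  /-- `send t j s i` is the message which learner `j` sends to its neighbour `i` in round `t` -/
  send : ℕ → Fin n → State → Fin n → Msg
  /-- the memory of learner `i` after it has received the messages of round `t`; the entry of the
  inbox for a learner that is not a neighbour is `none` -/
  receive : ℕ → Fin n → State → (Fin n → Option Msg) → State

namespace DOCOAlgorithm

variable {n d : ℕ} {K : Set (EuclideanSpace ℝ (Fin d))} {T C : ℕ}

open Classical in
/-- The memories of all learners at the end of round `t` (initially, for `t = 0`), when the
algorithm is run on the network `(Γ, P)` and the loss function of learner `i` in round `t` is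
`f t i`. -/
noncomputable def stateAfter (A : DOCOAlgorithm.{u, v} n d K T C) (Γ : SimpleGraph (Fin n))
    (P : Matrix (Fin n) (Fin n) ℝ) (f : ℕ → Fin n → EuclideanSpace ℝ (Fin d) → ℝ) :
    ℕ → Fin n → A.State
  | 0 => A.init Γ P
  | t + 1 =>
    let s : Fin n → A.State := fun i =>
      A.observe (t + 1) i (stateAfter A Γ P f t i) (f (t + 1) i)
    if t + 1 ∈ A.commRounds Γ P then
      fun i => A.receive (t + 1) i (s i)
        (fun j => if Γ.Adj i j then some (A.send (t + 1) j (s j) i) else none)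
    else s

/-- The decision `x_i(t)` of learner `i` in round `t ≥ 1`. -/
noncomputable def decision (A : DOCOAlgorithm.{u, v} n d K T C) (Γ : SimpleGraph (Fin n))
    (P : Matrix (Fin n) (Fin n) ℝ) (f : ℕ → Fin n → EuclideanSpace ℝ (Fin d) → ℝ)
    (i : Fin n) (t : ℕ) : EuclideanSpace ℝ (Fin d) :=
  A.decide t i (A.stateAfter Γ P f (t - 1) i)

/-- The regret `R_{T,i}` of learner `i` with respect to the global functions
`f_t = ∑ j, f_{t,j}`. (For continuous losses on a nonempty compact `K` the infimum is a
minimum.) -/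
noncomputable def regret (A : DOCOAlgorithm.{u, v} n d K T C) (Γ : SimpleGraph (Fin n))
    (P : Matrix (Fin n) (Fin n) ℝ) (f : ℕ → Fin n → EuclideanSpace ℝ (Fin d) → ℝ)
    (i : Fin n) : ℝ :=
  (∑ t ∈ Finset.Icc 1 T, ∑ j, f t j (A.decision Γ P f i t)) -
    sInf ((fun x => ∑ t ∈ Finset.Icc 1 T, ∑ j, f t j x) '' K)

end DOCOAlgorithm

/-! Information crosses one edge of the cycle per communication round. Take `D` about `n / 4` and
give losses only to the vertices at distance at least `D` from vertex `0`, which are at least half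
of all vertices. They share one linear loss along the diagonal of the cube, with an independent
random sign per block; a new block starts after every `D` communications. While a block lasts, its
sign cannot have reached vertex `0` (`decision_blockLoss_update`), so the expected loss of vertex
`0` vanishes. The best fixed point is a corner of the cube, which gains `S * R * G` times the
absolute signed sum of the block lengths, `S` being the number of far vertices. Khintchine bounds
its mean below by `T / √(3 * Z)` for `Z` blocks, wherever the communications are placed
(`sum_abs_signedRounds_ge`), and some choice of signs is at least as bad as the mean
(`exists_blockLoss_regret_ge`).

With `Z` of order `C / D`, this yields regret of order `n * R * G * T * √(n / C)`. For the lazy walk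
on the cycle, `sigmaTwo_lazyCycleMatrix_le` gives a gap `ρ ≥ 6 / (n ^ 2 + 2)`, so `√n` dominates a
multiple of `ρ ^ (-1/4)`. If `C < D` there is a single block and the regret is linear in `T`. -/

/-! ### Rademacher sums and Khintchine's inequality -/

/-- The sign `±1` encoded by a Boolean. -/
def boolSign (b : Bool) : ℝ := if b then 1 else -1

lemma boolSign_not (b : Bool) : boolSign (!b) = -boolSign b := by
  cases b <;> simp [boolSign]

lemma abs_boolSign (b : Bool) : |boolSign b| = 1 := by
  cases b <;> simp [boolSign]

lemma sum_boolVec_succ {k : ℕ} (F : (Fin (k + 1) → Bool) → ℝ) :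
    ∑ ε, F ε = ∑ ε : Fin k → Bool, (F (Fin.cons true ε) + F (Fin.cons false ε)) := by
  rw [← (Fin.consEquiv (fun _ : Fin (k + 1) => Bool)).sum_comp, Fintype.sum_prod_type]
  simp [Fin.consEquiv, Finset.sum_add_distrib]

lemma sum_sq_rademacher {k : ℕ} (a : Fin k → ℝ) :
    ∑ ε : Fin k → Bool, (∑ z, boolSign (ε z) * a z) ^ 2 = 2 ^ k * ∑ z, a z ^ 2 := by
  induction k with
  | zero => simp
  | succ k ih =>
    rw [sum_boolVec_succ]
    have h : ∀ ε : Fin k → Bool,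
        (∑ z, boolSign ((Fin.cons true ε : Fin (k + 1) → Bool) z) * a z) ^ 2 +
          (∑ z, boolSign ((Fin.cons false ε : Fin (k + 1) → Bool) z) * a z) ^ 2 =
        2 * (∑ z, boolSign (ε z) * a z.succ) ^ 2 + 2 * a 0 ^ 2 := by
      intro ε
      simp only [Fin.sum_univ_succ, Fin.cons_zero, Fin.cons_succ, boolSign]
      simp
      ring
    rw [Finset.sum_congr rfl fun ε _ => h ε, Finset.sum_add_distrib, ← Finset.mul_sum,
      ih (fun z => a z.succ), Fin.sum_univ_succ]
    simp
    ring

lemma sum_pow_four_rademacher_le {k : ℕ} (a : Fin k → ℝ) :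
    ∑ ε : Fin k → Bool, (∑ z, boolSign (ε z) * a z) ^ 4 ≤ 2 ^ k * (3 * (∑ z, a z ^ 2) ^ 2) := by
  induction k with
  | zero => simp
  | succ k ih =>
    rw [sum_boolVec_succ]
    have h : ∀ ε : Fin k → Bool,
        (∑ z, boolSign ((Fin.cons true ε : Fin (k + 1) → Bool) z) * a z) ^ 4 +
          (∑ z, boolSign ((Fin.cons false ε : Fin (k + 1) → Bool) z) * a z) ^ 4 =
        2 * (∑ z, boolSign (ε z) * a z.succ) ^ 4 +
          12 * a 0 ^ 2 * (∑ z, boolSign (ε z) * a z.succ) ^ 2 + 2 * a 0 ^ 4 := by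
      intro ε
      simp only [Fin.sum_univ_succ, Fin.cons_zero, Fin.cons_succ, boolSign]
      simp
      ring
    rw [Finset.sum_congr rfl fun ε _ => h ε, Finset.sum_add_distrib, Finset.sum_add_distrib,
      ← Finset.mul_sum, ← Finset.mul_sum, sum_sq_rademacher (fun z => a z.succ),
      Fin.sum_univ_succ]
    have h4 := ih (fun z => a z.succ)
    simp only [Finset.sum_const, Finset.card_univ, Fintype.card_pi, Fintype.card_bool,
      Finset.prod_const, Fintype.card_fin, nsmul_eq_mul, Nat.cast_pow, Nat.cast_ofNat]
    have h5 : (0 : ℝ) ≤ 2 ^ k * a 0 ^ 4 := by positivity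
    rw [pow_succ (2 : ℝ) k]
    nlinarith

/-- The quartic minorant touches `|x|` at `√3`, hence the double root in the factorization. This
choice is optimal when the second moment is `1` and the fourth at most `3`; it gives the mean
`1/√3`. -/
lemma sq_sub_pow_four_le_abs (x : ℝ) :
    √3 / 2 * x ^ 2 - x ^ 4 / (6 * √3) ≤ |x| := by
  have h3 : √3 ^ 2 = 3 := Real.sq_sqrt (by norm_num)
  have hp : 0 < √3 := by positivity
  set y := |x| with hy
  have h2 : x ^ 2 = y ^ 2 := (sq_abs x).symm
  have h4 : x ^ 4 = y ^ 4 := by rw [show x ^ 4 = (x ^ 2) ^ 2 by ring, h2]; ring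
  have hy0 : 0 ≤ y := abs_nonneg x
  rw [h2, h4, sub_le_iff_le_add, ← sub_nonneg]
  have : y + y ^ 4 / (6 * √3) - √3 / 2 * y ^ 2 = y * ((y - √3) ^ 2 * (y + 2 * √3)) / (6 * √3) := by
    field_simp
    linear_combination (-4 * y * √3) * h3
  rw [this]
  positivity

/-- The Khintchine inequality for the first moment, with constant `1/√3`. -/
lemma khintchine_one {k : ℕ} (a : Fin k → ℝ) :
    2 ^ k * √((∑ z, a z ^ 2) / 3) ≤ ∑ ε : Fin k → Bool, |∑ z, boolSign (ε z) * a z| := by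
  set q := ∑ z, a z ^ 2 with hq
  have hq0 : 0 ≤ q := Finset.sum_nonneg fun z _ => sq_nonneg _
  rcases hq0.eq_or_lt with h0 | hpos
  · rw [← h0]
    simpa using Finset.sum_nonneg fun ε _ => abs_nonneg _
  have hs : 0 < √q := Real.sqrt_pos.2 hpos
  have hs2 : √q ^ 2 = q := Real.sq_sqrt hq0
  have h3 : √3 ^ 2 = 3 := Real.sq_sqrt (by norm_num)
  have hp : 0 < √3 := by positivity
  have hpt : ∀ ε : Fin k → Bool,
      √3 / (2 * √q) * (∑ z, boolSign (ε z) * a z) ^ 2 -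
        1 / (6 * √3 * √q ^ 3) * (∑ z, boolSign (ε z) * a z) ^ 4 ≤
      |∑ z, boolSign (ε z) * a z| := by
    intro ε
    set x := ∑ z, boolSign (ε z) * a z
    have := mul_le_mul_of_nonneg_left (sq_sub_pow_four_le_abs (x / √q)) hs.le
    rw [abs_div, abs_of_pos hs, mul_div_cancel₀ _ hs.ne'] at this
    refine le_trans (le_of_eq ?_) this
    field_simp
  refine le_trans ?_ (Finset.sum_le_sum fun ε _ => hpt ε)
  rw [Finset.sum_sub_distrib, ← Finset.mul_sum, ← Finset.mul_sum, sum_sq_rademacher]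
  have h4 := mul_le_mul_of_nonneg_left (sum_pow_four_rademacher_le a)
    (by positivity : 0 ≤ 1 / (6 * √3 * √q ^ 3))
  rw [← hq] at h4 ⊢
  refine le_trans (le_of_eq ?_) (sub_le_sub_left h4 _)
  rw [Real.sqrt_div hq0]
  rw [show q = √q ^ 2 from hs2.symm, Real.sqrt_sq hs.le]
  field_simp
  rw [h3]
  norm_num

/-- Cauchy–Schwarz removes the dependence on the individual `a z`: only their total and their number
matter. -/
lemma sum_abs_rademacher_ge {k : ℕ} (hk : 0 < k) (a : Fin k → ℝ) :
    2 ^ k * (|∑ z, a z| / √(3 * k)) ≤ ∑ ε : Fin k → Bool, |∑ z, boolSign (ε z) * a z| := by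
  refine le_trans ?_ (khintchine_one a)
  gcongr
  have hk' : (0 : ℝ) < k := by exact_mod_cast hk
  rw [← Real.sqrt_sq_eq_abs, ← Real.sqrt_div (sq_nonneg _)]
  apply Real.sqrt_le_sqrt
  have := sq_sum_le_card_mul_sum_sq (s := Finset.univ) (f := a)
  simp at this
  rw [div_le_div_iff₀ (by positivity) (by norm_num)]
  nlinarith

/-- A quantity that does not depend on the sign of block `z` is uncorrelated with that sign. -/
lemma sum_boolSign_mul_eq_zero {k : ℕ} (z : Fin k) (F : (Fin k → Bool) → ℝ)
    (hF : ∀ ε b, F (Function.update ε z b) = F ε) :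
    ∑ ε, boolSign (ε z) * F ε = 0 := by
  -- Flipping the sign `z` pairs the terms of the sum into opposite ones.
  have hinv : Function.Involutive fun ε : Fin k → Bool => Function.update ε z (!ε z) := by
    intro ε
    simp
  have := Equiv.sum_comp (Function.Involutive.toPerm _ hinv) fun ε => boolSign (ε z) * F ε
  simp [hF, boolSign_not, Function.Involutive.coe_toPerm] at this
  linarith

/-! ### Second singular value -/

open InnerProductSpace Module in
/-- One inequality of the Courant–Fischer characterization of the second singular value. -/
lemma LinearMap.singularValues_one_le_of_orthogonal {E : Type*} [NormedAddCommGroup E]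
    [InnerProductSpace ℝ E] [FiniteDimensional ℝ E] (T : E →ₗ[ℝ] E) (v : E) {c : ℝ} (hc : 0 ≤ c)
    (h : ∀ x, inner ℝ v x = 0 → ‖T x‖ ≤ c * ‖x‖) : T.singularValues 1 ≤ c := by
  rcases le_or_gt (finrank ℝ E) 1 with h1 | h1
  · rw [T.singularValues_of_finrank_le h1]; exact hc
  have hT := T.isSymmetric_adjoint_comp_self
  set i0 : Fin (finrank ℝ E) := ⟨0, by omega⟩
  set i1 : Fin (finrank ℝ E) := ⟨1, h1⟩
  set b := hT.eigenvectorBasis rfl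
  have hne : i0 ≠ i1 := by simp [i0, i1]
  -- The plane of the two top eigenvectors of `adjoint T ∘ T` meets the orthogonal complement of `v`
  -- nontrivially; there `T` stretches by at least the second singular value.
  obtain ⟨α, β, hαβ, hv⟩ : ∃ α β : ℝ, 0 < α ^ 2 + β ^ 2 ∧
      α * inner ℝ v (b i0) + β * inner ℝ v (b i1) = 0 := by
    by_cases h0 : inner ℝ v (b i0) = 0
    · exact ⟨1, 0, by norm_num, by simp [h0]⟩
    · exact ⟨-inner ℝ v (b i1), inner ℝ v (b i0), by positivity, by ring⟩
  set x := α • b i0 + β • b i1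
  have hx : inner ℝ v x = 0 := by simpa [x, inner_add_right, inner_smul_right] using hv
  have hb := b.orthonormal
  have h00 : ∀ i, inner ℝ (b i) (b i) = (1 : ℝ) := fun i => by simp
  have h01 : inner ℝ (b i0) (b i1) = (0 : ℝ) := hb.2 hne
  have h10 : inner ℝ (b i1) (b i0) = (0 : ℝ) := hb.2 hne.symm
  have hnx : ‖x‖ ^ 2 = α ^ 2 + β ^ 2 := by
    rw [← real_inner_self_eq_norm_sq]
    simp only [x, inner_add_left, inner_add_right, inner_smul_left, inner_smul_right, h00, h01, h10]
    simp
    ring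
  have e : ∀ i, adjoint T (T (b i)) = hT.eigenvalues rfl i • b i := fun i =>
    hT.apply_eigenvectorBasis rfl i
  have hTx : ‖T x‖ ^ 2 = α ^ 2 * hT.eigenvalues rfl i0 + β ^ 2 * hT.eigenvalues rfl i1 := by
    rw [← real_inner_self_eq_norm_sq, ← LinearMap.adjoint_inner_right]
    simp only [x, map_add, map_smul, e, inner_add_left, inner_add_right, inner_smul_left,
      inner_smul_right, h00, h01, h10]
    simp
    ring
  have hanti : hT.eigenvalues rfl i1 ≤ hT.eigenvalues rfl i0 :=
    hT.eigenvalues_antitone rfl (by simp [i0, i1, Fin.le_def])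
  have hle : ‖T x‖ ^ 2 ≤ c ^ 2 * ‖x‖ ^ 2 := by
    rw [← mul_pow]; exact pow_le_pow_left₀ (norm_nonneg _) (h x hx) 2
  refine le_of_sq_le_sq ?_ hc
  rw [T.sq_singularValues_of_lt rfl h1]
  change hT.eigenvalues rfl i1 ≤ _
  rw [hTx, hnx] at hle
  have := mul_le_mul_of_nonneg_left hanti (sq_nonneg α)
  exact le_of_mul_le_mul_right (by nlinarith) hαβ

/-! ### Poincaré inequality and spectral gap of the cycle -/

section Shift

variable {A : Type*} [AddCommGroup A] [Fintype A]

lemma sum_comp_add_right (F : A → ℝ) (g : A) : ∑ i, F (i + g) = ∑ i, F i :=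
  Equiv.sum_comp (Equiv.addRight g) F

/-- Telescope along `j` unit shifts and apply Cauchy–Schwarz; translation invariance makes all `j`
energies equal. -/
lemma sum_sq_shift_nsmul_le (x : A → ℝ) (g : A) (j : ℕ) :
    ∑ i, (x (i + j • g) - x i) ^ 2 ≤ (j : ℝ) ^ 2 * ∑ i, (x (i + g) - x i) ^ 2 := by
  have h : ∀ i, (x (i + j • g) - x i) ^ 2 ≤
      j * ∑ s ∈ Finset.range j, (x (i + s • g + g) - x (i + s • g)) ^ 2 := by
    intro i
    have h1 := Finset.sum_range_sub (fun s => x (i + s • g)) j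
    simp only [succ_nsmul, ← add_assoc, zero_nsmul, add_zero] at h1
    rw [← h1]
    simpa using sq_sum_le_card_mul_sum_sq (s := Finset.range j)
      (f := fun s => x (i + s • g + g) - x (i + s • g))
  refine (Finset.sum_le_sum fun i _ => h i).trans (le_of_eq ?_)
  rw [← Finset.mul_sum, Finset.sum_comm]
  have h2 : ∀ s : ℕ, ∑ i, (x (i + s • g + g) - x (i + s • g)) ^ 2 =
      ∑ i, (x (i + g) - x i) ^ 2 := fun s =>
    sum_comp_add_right (fun i => (x (i + g) - x i) ^ 2) (s • g)
  simp only [h2, Finset.sum_const, Finset.card_range, nsmul_eq_mul]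
  ring

lemma sum_sum_sq_shift_eq (x : A → ℝ) (hx : ∑ i, x i = 0) :
    ∑ k, ∑ i, (x (i + k) - x i) ^ 2 = 2 * Fintype.card A * ∑ i, x i ^ 2 := by
  have h1 : ∀ i, ∑ k, (x (i + k) - x i) ^ 2 = ∑ k, x k ^ 2 + Fintype.card A * x i ^ 2 := by
    intro i
    have := Equiv.sum_comp (Equiv.addLeft i) fun k => (x k - x i) ^ 2
    simp only [Equiv.coe_addLeft] at this
    rw [this]
    simp only [sub_sq, Finset.sum_add_distrib, Finset.sum_sub_distrib, ← Finset.sum_mul,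
      ← Finset.mul_sum, hx]
    simp
  rw [Finset.sum_comm]
  simp only [h1, Finset.sum_add_distrib, ← Finset.mul_sum]
  simp
  ring

end Shift

section Cycle

variable {n : ℕ} [NeZero n]

lemma Fin.eq_val_nsmul_one (k : Fin n) : k = k.val • (1 : Fin n) := by
  have : ∀ j : ℕ, j < n → (j • (1 : Fin n)).val = j := by
    intro j
    induction j with
    | zero => simp
    | succ j ih =>
      intro hj
      have h1 : (1 : Fin n).val = 1 := by
        rw [Fin.val_one', Nat.mod_eq_of_lt (by omega)]
      rw [succ_nsmul, Fin.val_add, ih (by omega), h1, Nat.mod_eq_of_lt hj]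
  exact Fin.ext (this k.val k.isLt).symm

lemma sum_sq_shift_le_min (x : Fin n → ℝ) (k : Fin n) :
    ∑ i, (x (i + k) - x i) ^ 2 ≤
      ((min k.val (n - k.val) : ℕ) : ℝ) ^ 2 * ∑ i, (x (i + 1) - x i) ^ 2 := by
  rcases le_total k.val (n - k.val) with h | h
  · rw [min_eq_left h]
    conv_lhs => rw [Fin.eq_val_nsmul_one k]
    exact sum_sq_shift_nsmul_le x 1 k.val
  · rw [min_eq_right h]
    have hn : n • (1 : Fin n) = 0 := by
      have := card_nsmul_eq_zero (G := Fin n) (x := 1)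
      simpa using this
    have hk : (n - k.val) • (1 : Fin n) = -k := by
      rw [eq_neg_iff_add_eq_zero]
      calc (n - k.val) • (1 : Fin n) + k = (n - k.val) • (1 : Fin n) + k.val • (1 : Fin n) := by
            rw [← Fin.eq_val_nsmul_one k]
        _ = 0 := by rw [← add_nsmul, Nat.sub_add_cancel k.isLt.le, hn]
    refine le_trans (le_of_eq ?_) (sum_sq_shift_nsmul_le x 1 (n - k.val))
    rw [hk, ← sum_comp_add_right (fun i => (x (i + -k) - x i) ^ 2) k]
    refine Finset.sum_congr rfl fun i _ => ?_
    rw [add_neg_cancel_right]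
    ring

lemma sum_range_sq_real (h : ℕ) :
    ∑ k ∈ Finset.range h, (k : ℝ) ^ 2 = h * (h - 1) * (2 * h - 1) / 6 := by
  induction h with
  | zero => simp
  | succ h ih => rw [Finset.sum_range_succ, ih]; push_cast; ring

lemma sum_sq_min_cycle (h : ℕ) :
    ∑ k : Fin (2 * h), ((min k.val (2 * h - k.val) : ℕ) : ℝ) ^ 2 =
      h * (2 * h ^ 2 + 1) / 3 := by
  rw [Fin.sum_univ_eq_sum_range (fun k => ((min k (2 * h - k) : ℕ) : ℝ) ^ 2), two_mul,
    Finset.sum_range_add]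
  have h1 : ∑ k ∈ Finset.range h, ((min k (h + h - k) : ℕ) : ℝ) ^ 2 =
      ∑ k ∈ Finset.range h, (k : ℝ) ^ 2 := by
    refine Finset.sum_congr rfl fun k hk => ?_
    rw [Finset.mem_range] at hk
    rw [min_eq_left (by omega)]
  have h2 : ∑ k ∈ Finset.range h, ((min (h + k) (h + h - (h + k)) : ℕ) : ℝ) ^ 2 =
      ∑ k ∈ Finset.range h, ((k + 1 : ℕ) : ℝ) ^ 2 := by
    rw [← Finset.sum_range_reflect]
    refine Finset.sum_congr rfl fun k hk => ?_
    rw [Finset.mem_range] at hk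
    rw [min_eq_right (by omega)]
    congr 2
    omega
  have h3 := sum_range_sq_real (h + 1)
  rw [Finset.sum_range_succ'] at h3
  rw [h1, h2, sum_range_sq_real]
  push_cast at h3 ⊢
  linear_combination h3

/-- A Poincaré inequality on the cycle. -/
lemma cycle_poincare {h : ℕ} (hn : n = 2 * h) (x : Fin n → ℝ) (hx : ∑ i, x i = 0) :
    24 * ∑ i, x i ^ 2 ≤ ((n : ℝ) ^ 2 + 2) * ∑ i, (x (i + 1) - x i) ^ 2 := by
  -- The variance is an average over all pairs; each pair is joined by the shorter of its two arcs.
  have h1 := sum_sum_sq_shift_eq x hx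
  have h2 := Finset.sum_le_sum fun k (_ : k ∈ Finset.univ) => sum_sq_shift_le_min x k
  rw [h1, ← Finset.sum_mul, Fintype.card_fin] at h2
  have h3 : ∑ k : Fin n, ((min k.val (n - k.val) : ℕ) : ℝ) ^ 2 = h * (2 * h ^ 2 + 1) / 3 := by
    rw [← sum_sq_min_cycle h]
    clear h1 h2 hx x
    subst hn
    rfl
  rw [h3] at h2
  have hpos : (0 : ℝ) < h := by
    have := NeZero.pos n
    exact_mod_cast (by omega : 0 < h)
  have hn' : (n : ℝ) = 2 * h := by rw [hn]; push_cast; ring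
  rw [hn'] at h2 ⊢
  refine le_of_mul_le_mul_left ?_ hpos
  nlinarith

lemma sum_sq_add_shift_le {h : ℕ} (hn : n = 2 * h) (x : Fin n → ℝ) (hx : ∑ i, x i = 0) :
    ∑ i, (x i + x (i + 1)) ^ 2 ≤ 4 * (1 - 6 / ((n : ℝ) ^ 2 + 2)) * ∑ i, x i ^ 2 := by
  have h1 := cycle_poincare hn x hx
  have h2 := sum_comp_add_right (fun i => x i ^ 2) (1 : Fin n)
  have h3 : ∑ i, (x i + x (i + 1)) ^ 2 = 4 * ∑ i, x i ^ 2 - ∑ i, (x (i + 1) - x i) ^ 2 := by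
    rw [← sub_eq_zero]
    have : ∀ i, (x i + x (i + 1)) ^ 2 + (x (i + 1) - x i) ^ 2 = 2 * x i ^ 2 + 2 * x (i + 1) ^ 2 :=
      fun i => by ring
    have := Finset.sum_congr rfl fun i (_ : i ∈ Finset.univ) => this i
    simp only [Finset.sum_add_distrib, ← Finset.mul_sum] at this
    linarith
  have hp : (0 : ℝ) < (n : ℝ) ^ 2 + 2 := by positivity
  rw [h3, mul_sub, sub_mul, mul_one]
  have : 4 * (6 / ((n : ℝ) ^ 2 + 2)) * ∑ i, x i ^ 2 = 24 * (∑ i, x i ^ 2) / ((n : ℝ) ^ 2 + 2) := by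
    ring
  rw [this]
  have : 24 * (∑ i, x i ^ 2) / ((n : ℝ) ^ 2 + 2) ≤ ∑ i, (x (i + 1) - x i) ^ 2 := by
    rw [div_le_iff₀ hp]; linarith
  linarith

variable (n) in
/-- The transition matrix of the lazy simple random walk on the cycle. -/
noncomputable def lazyCycleMatrix : Matrix (Fin n) (Fin n) ℝ :=
  Matrix.of fun i j =>
    (if j = i then 1 / 2 else 0) + (if j = i + 1 then 1 / 4 else 0) +
      (if j = i - 1 then 1 / 4 else 0)

lemma lazyCycleMatrix_mulVec (x : Fin n → ℝ) (i : Fin n) :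
    (lazyCycleMatrix n).mulVec x i = (x i + x (i + 1) + (x (i - 1) + x i)) / 4 := by
  simp only [Matrix.mulVec, dotProduct, lazyCycleMatrix, Matrix.of_apply, add_mul,
    Finset.sum_add_distrib, ite_mul, zero_mul, Finset.sum_ite_eq', Finset.mem_univ, if_true]
  ring

lemma lazyCycleMatrix_isSymm : (lazyCycleMatrix n).IsSymm := by
  ext i j
  simp only [lazyCycleMatrix, Matrix.transpose_apply, Matrix.of_apply]
  have h1 : i = j ↔ j = i := eq_comm
  have h2 : i = j + 1 ↔ j = i - 1 := by rw [eq_comm, ← eq_sub_iff_add_eq]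
  have h3 : i = j - 1 ↔ j = i + 1 := by rw [eq_sub_iff_add_eq, eq_comm]
  simp only [h1, h2, h3]
  ring

lemma lazyCycleMatrix_row_sum (i : Fin n) : ∑ j, lazyCycleMatrix n i j = 1 := by
  simp [lazyCycleMatrix, Finset.sum_add_distrib]
  norm_num

lemma lazyCycleMatrix_posSemidef : (lazyCycleMatrix n).PosSemidef := by
  refine Matrix.PosSemidef.of_dotProduct_mulVec_nonneg ?_ fun x => ?_
  · rw [Matrix.IsHermitian, Matrix.conjTranspose_eq_transpose_of_trivial]
    exact lazyCycleMatrix_isSymm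
  have : star x ⬝ᵥ (lazyCycleMatrix n).mulVec x = (∑ i, (x i + x (i + 1)) ^ 2) / 4 := by
    simp only [dotProduct, lazyCycleMatrix_mulVec, Pi.star_apply, star_trivial]
    have h1 : ∑ i, x i * (x (i - 1) + x i) = ∑ i, x (i + 1) * (x i + x (i + 1)) := by
      rw [← sum_comp_add_right (fun i => x i * (x (i - 1) + x i)) 1]
      simp
    have h2 : ∑ i, x i * ((x i + x (i + 1) + (x (i - 1) + x i)) / 4) =
        (∑ i, x i * (x i + x (i + 1)) + ∑ i, x i * (x (i - 1) + x i)) / 4 := by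
      rw [← Finset.sum_add_distrib, Finset.sum_div]
      exact Finset.sum_congr rfl fun i _ => by ring
    rw [h2, h1, ← Finset.sum_add_distrib]
    congr 1
    exact Finset.sum_congr rfl fun i _ => by ring
  rw [this]
  positivity

lemma sigmaTwo_lazyCycleMatrix_le {h : ℕ} (hn : n = 2 * h) (hh : 2 ≤ h) :
    sigmaTwo (lazyCycleMatrix n) ≤ 1 - 6 / ((n : ℝ) ^ 2 + 2) := by
  have hn4 : (4 : ℝ) ≤ n := by exact_mod_cast (by omega : 4 ≤ n)
  have hc : 0 ≤ 1 - 6 / ((n : ℝ) ^ 2 + 2) := by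
    rw [sub_nonneg, div_le_one (by positivity)]
    nlinarith
  refine LinearMap.singularValues_one_le_of_orthogonal _ (WithLp.toLp 2 fun _ => 1) hc ?_
  intro x hx
  have hx0 : ∑ i, x i = 0 := by simpa [PiLp.inner_apply] using hx
  refine le_of_sq_le_sq ?_ (by positivity)
  rw [mul_pow, EuclideanSpace.real_norm_sq_eq, EuclideanSpace.real_norm_sq_eq]
  have h1 : ∀ i, (Matrix.toEuclideanLin (lazyCycleMatrix n) x) i =
      (x i + x (i + 1) + (x (i - 1) + x i)) / 4 := fun i =>
    lazyCycleMatrix_mulVec x.ofLp i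
  simp only [h1]
  -- The matrix is, up to a shift, a quarter of the square of `x ↦ x i + x (i + 1)`. Using the
  -- contraction twice gives the gap without loss.
  set z : Fin n → ℝ := fun i => x i + x (i + 1) with hz
  have hz0 : ∑ i, z i = 0 := by
    simp only [hz, Finset.sum_add_distrib, sum_comp_add_right (fun i => x i), hx0, add_zero]
  have h2 := sum_sq_add_shift_le hn z hz0
  have h3 := sum_sq_add_shift_le hn (fun i => x i) hx0
  have h4 : ∑ i, ((x i + x (i + 1) + (x (i - 1) + x i)) / 4) ^ 2 =
      (∑ i, (z i + z (i + 1)) ^ 2) / 16 := by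
    rw [← sum_comp_add_right (fun i => ((x i + x (i + 1) + (x (i - 1) + x i)) / 4) ^ 2) 1,
      Finset.sum_div]
    refine Finset.sum_congr rfl fun i _ => ?_
    simp only [hz, add_sub_cancel_right]
    ring
  rw [h4]
  have h5 := mul_le_mul_of_nonneg_left h3 hc
  change _ ≤ 4 * _ * ∑ i, (x i + x (i + 1)) ^ 2 at h2
  nlinarith

lemma isCommunicationMatrix_lazyCycleMatrix {h : ℕ} (hn : n = 2 * h) (hh : 2 ≤ h) :
    IsCommunicationMatrix (SimpleGraph.cycleGraph n) (lazyCycleMatrix n) where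
  supported i j hij := by
    have h1 : (1 : Fin n).val = 1 := by rw [Fin.val_one', Nat.mod_eq_of_lt (by omega)]
    rw [SimpleGraph.cycleGraph_adj']
    by_contra hcon
    push Not at hcon
    obtain ⟨⟨ha, hb⟩, hc⟩ := hcon
    have e1 : j ≠ i + 1 := by rintro rfl; rw [add_sub_cancel_left] at hb; exact hb h1
    have e2 : j ≠ i - 1 := by rintro rfl; rw [sub_sub_cancel] at ha; exact ha h1
    simp [lazyCycleMatrix, e1, e2, Ne.symm hc] at hij
  symmetric := lazyCycleMatrix_isSymm
  nonneg i j := by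
    simp only [lazyCycleMatrix, Matrix.of_apply]
    positivity
  row_sum := lazyCycleMatrix_row_sum
  col_sum j := by
    rw [← lazyCycleMatrix_row_sum j]
    exact Finset.sum_congr rfl fun i _ => (lazyCycleMatrix_isSymm.apply i j).symm
  posSemidef := lazyCycleMatrix_posSemidef
  sigmaTwo_lt_one := by
    refine (sigmaTwo_lazyCycleMatrix_le hn hh).trans_lt ?_
    have : (0 : ℝ) < 6 / ((n : ℝ) ^ 2 + 2) := by positivity
    linarith

end Cycle

/-! ### Propagation of information on the cycle -/

/-- The distance of a vertex of the cycle from the vertex `0`. -/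
def cycleLevel {n : ℕ} (i : Fin n) : ℕ := min i.val (n - i.val)

lemma cycleLevel_le_succ_of_adj {n : ℕ} {i j : Fin n} (h : (SimpleGraph.cycleGraph n).Adj i j) :
    cycleLevel j ≤ cycleLevel i + 1 := by
  rw [SimpleGraph.cycleGraph_adj'] at h
  have hi := i.isLt
  have hj := j.isLt
  simp only [cycleLevel]
  rcases h with h | h <;> rw [Fin.val_sub] at h
  · rcases lt_or_ge (n - j.val + i.val) n with h1 | h1
    · rw [Nat.mod_eq_of_lt h1] at h
      omega
    · rw [Nat.mod_eq_sub_mod h1, Nat.mod_eq_of_lt (by omega)] at h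
      omega
  · rcases lt_or_ge (n - i.val + j.val) n with h1 | h1
    · rw [Nat.mod_eq_of_lt h1] at h
      omega
    · rw [Nat.mod_eq_sub_mod h1, Nat.mod_eq_of_lt (by omega)] at h
      omega

/-- The vertices of the cycle at distance at least `D` from the vertex `0`. -/
def farVertices (n D : ℕ) : Finset (Fin n) := Finset.univ.filter fun i => D ≤ cycleLevel i

lemma card_farVertices {n D : ℕ} (hD : 0 < D) (hDn : 2 * D ≤ n) :
    (farVertices n D).card = n + 1 - 2 * D := by
  have : (farVertices n D).map Fin.valEmbedding = Finset.Icc D (n - D) := by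
    ext k
    simp only [farVertices, Finset.mem_map, Finset.mem_filter, Finset.mem_univ,
      true_and, Fin.valEmbedding_apply, Finset.mem_Icc]
    constructor
    · rintro ⟨i, hi, rfl⟩
      have := i.isLt
      rw [cycleLevel] at hi
      omega
    · rintro ⟨h1, h2⟩
      exact ⟨⟨k, by omega⟩, by change D ≤ min k (n - k); omega, rfl⟩
  rw [← Finset.card_map, this, Nat.card_Icc]
  omega

namespace DOCOAlgorithm

variable {n d : ℕ} {K : Set (EuclideanSpace ℝ (Fin d))} {T C : ℕ}

/-- The number of communication rounds up to and including round `t`. -/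
def commCount (A : DOCOAlgorithm.{u, v} n d K T C) (Γ : SimpleGraph (Fin n))
    (P : Matrix (Fin n) (Fin n) ℝ) (t : ℕ) : ℕ :=
  ((A.commRounds Γ P).filter (· ≤ t)).card

lemma commCount_le (A : DOCOAlgorithm.{u, v} n d K T C) (Γ : SimpleGraph (Fin n))
    (P : Matrix (Fin n) (Fin n) ℝ) (t : ℕ) : A.commCount Γ P t ≤ C :=
  (Finset.card_filter_le _ _).trans (A.card_commRounds Γ P).le

lemma commCount_mono (A : DOCOAlgorithm.{u, v} n d K T C) (Γ : SimpleGraph (Fin n))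
    (P : Matrix (Fin n) (Fin n) ℝ) (t : ℕ) : A.commCount Γ P t ≤ A.commCount Γ P (t + 1) :=
  Finset.card_le_card (Finset.monotone_filter_right _ fun _ _ h => by omega)

lemma commCount_succ (A : DOCOAlgorithm.{u, v} n d K T C) (Γ : SimpleGraph (Fin n))
    (P : Matrix (Fin n) (Fin n) ℝ) {t : ℕ} (h : t + 1 ∈ A.commRounds Γ P) :
    A.commCount Γ P (t + 1) = A.commCount Γ P t + 1 := by
  have : (A.commRounds Γ P).filter (· ≤ t + 1) =
      insert (t + 1) ((A.commRounds Γ P).filter (· ≤ t)) := by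
    ext s
    simp only [Finset.mem_filter, Finset.mem_insert]
    constructor
    · rintro ⟨h1, h2⟩
      rcases h2.eq_or_lt with h3 | h3
      · exact Or.inl h3
      · exact Or.inr ⟨h1, by omega⟩
    · rintro (rfl | ⟨h1, h2⟩)
      · exact ⟨h, le_rfl⟩
      · exact ⟨h1, by omega⟩
  rw [commCount, this, Finset.card_insert_of_notMem (by simp)]
  rfl

/-- If two loss sequences differ only at vertices far from `0` and in rounds before which the
number of communication rounds has quotient `z` by `D`, then vertices close to `0` cannot
distinguish them until enough communication rounds have passed. -/
lemma stateAfter_eq_of_far (A : DOCOAlgorithm.{u, v} n d K T C) (P : Matrix (Fin n) (Fin n) ℝ)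
    {f g : ℕ → Fin n → EuclideanSpace ℝ (Fin d) → ℝ} {D z : ℕ}
    (hfg : ∀ t i, cycleLevel i < D ∨
      A.commCount (SimpleGraph.cycleGraph n) P t / D ≠ z → f (t + 1) i = g (t + 1) i)
    (t : ℕ) (i : Fin n)
    (hi : cycleLevel i + A.commCount (SimpleGraph.cycleGraph n) P t < D * (z + 1)) :
    A.stateAfter (SimpleGraph.cycleGraph n) P f t i =
      A.stateAfter (SimpleGraph.cycleGraph n) P g t i := by
  induction t generalizing i with
  | zero => rfl
  | succ t ih =>
    set Γ := SimpleGraph.cycleGraph n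
    have key : ∀ j, cycleLevel j + A.commCount Γ P t < D * (z + 1) →
        A.observe (t + 1) j (A.stateAfter Γ P f t j) (f (t + 1) j) =
          A.observe (t + 1) j (A.stateAfter Γ P g t j) (g (t + 1) j) := by
      intro j hj
      rw [ih j hj, hfg t j]
      -- A differing loss needs level at least `D` and at least `D * z` past communications, which
      -- exceeds the bound `hj`.
      by_contra hcon
      push Not at hcon
      have h1 := Nat.div_mul_le_self (A.commCount Γ P t) D
      rw [hcon.2] at h1
      rw [mul_add, mul_comm D z] at hj
      omega
    have hmono := A.commCount_mono Γ P t
    by_cases hc : t + 1 ∈ A.commRounds Γ P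
    · have hsucc := A.commCount_succ Γ P hc
      simp only [stateAfter, if_pos hc]
      rw [key i (by omega)]
      congr 1
      funext j
      by_cases hadj : Γ.Adj i j
      · have := cycleLevel_le_succ_of_adj hadj
        -- A neighbour is at most one level farther, and the count was one smaller before this
        -- round.
        rw [if_pos hadj, if_pos hadj, key j (by omega)]
      · rw [if_neg hadj, if_neg hadj]
    · simp only [stateAfter, if_neg hc]
      exact key i (by omega)

/-! ### Random block losses and the regret they force -/

/-- The rounds are split into `C / D + 1` blocks, each containing at most `D` communication
rounds. -/
def block (A : DOCOAlgorithm.{u, v} n d K T C) (Γ : SimpleGraph (Fin n))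
    (P : Matrix (Fin n) (Fin n) ℝ) (D t : ℕ) : Fin (C / D + 1) :=
  ⟨A.commCount Γ P (t - 1) / D,
    Nat.lt_succ_of_le (Nat.div_le_div_right (A.commCount_le Γ P (t - 1)))⟩

/-- Far vertices of the cycle suffer a linear loss along the diagonal of the cube, with one sign
per block of rounds; the other vertices suffer no loss. -/
noncomputable def blockLoss (A : DOCOAlgorithm.{u, v} n d K T C) (P : Matrix (Fin n) (Fin n) ℝ)
    (G : ℝ) (D : ℕ) (ε : Fin (C / D + 1) → Bool) (t : ℕ) (i : Fin n)
    (x : EuclideanSpace ℝ (Fin d)) : ℝ :=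
  if i ∈ farVertices n D then
    boolSign (ε (A.block (SimpleGraph.cycleGraph n) P D t)) * (G / √d * ∑ k, x k)
  else 0

lemma decision_blockLoss_update (A : DOCOAlgorithm.{u, v} n d K T C)
    (P : Matrix (Fin n) (Fin n) ℝ) (G : ℝ) {D : ℕ} (hD : 0 < D) (ε : Fin (C / D + 1) → Bool)
    (i : Fin n) (hi : cycleLevel i = 0) (t : ℕ) (b : Bool) :
    A.decision (SimpleGraph.cycleGraph n) P (A.blockLoss P G D
      (Function.update ε (A.block (SimpleGraph.cycleGraph n) P D t) b)) i t =
    A.decision (SimpleGraph.cycleGraph n) P (A.blockLoss P G D ε) i t := by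
  rw [decision, decision]
  congr 1
  refine A.stateAfter_eq_of_far P (D := D)
    (z := A.commCount (SimpleGraph.cycleGraph n) P (t - 1) / D) ?_ _ _ ?_
  · intro s j hj
    funext x
    simp only [blockLoss]
    rcases hj with hj | hj
    · have : j ∉ farVertices n D := by simpa [farVertices] using hj
      rw [if_neg this, if_neg this]
    · rw [Function.update_of_ne]
      intro h
      exact hj (congrArg Fin.val h)
  · rw [hi, zero_add]
    exact Nat.lt_mul_div_succ _ hD

lemma isLinearMap_blockLoss (A : DOCOAlgorithm.{u, v} n d K T C) (P : Matrix (Fin n) (Fin n) ℝ)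
    (G : ℝ) (D : ℕ) (ε : Fin (C / D + 1) → Bool) (t : ℕ) (i : Fin n) :
    IsLinearMap ℝ (A.blockLoss P G D ε t i) := by
  constructor
  · intro x y
    simp only [blockLoss, PiLp.add_apply, Finset.sum_add_distrib]
    split_ifs <;> ring
  · intro c x
    simp only [blockLoss, PiLp.smul_apply, smul_eq_mul, ← Finset.mul_sum]
    split_ifs <;> ring

lemma abs_sum_coord_le (x : EuclideanSpace ℝ (Fin d)) : |∑ k, x k| ≤ √d * ‖x‖ := by
  rw [← Real.sqrt_sq_eq_abs, EuclideanSpace.norm_eq, ← Real.sqrt_mul (Nat.cast_nonneg d)]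
  apply Real.sqrt_le_sqrt
  simpa using sq_sum_le_card_mul_sum_sq (s := Finset.univ) (f := fun k => x k)

lemma blockLoss_lipschitz (A : DOCOAlgorithm.{u, v} n d K T C) (P : Matrix (Fin n) (Fin n) ℝ)
    (hd : 0 < d) {G : ℝ} (hG : 0 ≤ G) (D : ℕ) (ε : Fin (C / D + 1) → Bool) (t : ℕ) (i : Fin n)
    (x y : EuclideanSpace ℝ (Fin d)) :
    |A.blockLoss P G D ε t i x - A.blockLoss P G D ε t i y| ≤ G * ‖x - y‖ := by
  rw [← (A.isLinearMap_blockLoss P G D ε t i).map_sub]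
  simp only [blockLoss]
  split_ifs
  · have hd' : (0 : ℝ) < √d := by positivity
    rw [abs_mul, abs_boolSign, one_mul, abs_mul, abs_of_nonneg (by positivity)]
    calc G / √d * |∑ k, (x - y) k| ≤ G / √d * (√d * ‖x - y‖) := by
          gcongr; exact abs_sum_coord_le _
      _ = G * ‖x - y‖ := by field_simp
  · rw [abs_zero]; positivity

lemma sum_blockLoss (A : DOCOAlgorithm.{u, v} n d K T C) (P : Matrix (Fin n) (Fin n) ℝ)
    (G : ℝ) (D : ℕ) (ε : Fin (C / D + 1) → Bool) (t : ℕ) (x : EuclideanSpace ℝ (Fin d)) :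
    ∑ j, A.blockLoss P G D ε t j x = boolSign (ε (A.block (SimpleGraph.cycleGraph n) P D t)) *
      ((farVertices n D).card * (G / √d * ∑ k, x k)) := by
  simp only [blockLoss, Finset.sum_ite_mem, Finset.univ_inter, Finset.sum_const, nsmul_eq_mul]
  ring

/-- The number of rounds of `{1, …, T}`, counted with the sign of their block. -/
noncomputable def signedRounds (A : DOCOAlgorithm.{u, v} n d K T C)
    (P : Matrix (Fin n) (Fin n) ℝ) (D : ℕ) (ε : Fin (C / D + 1) → Bool) : ℝ :=
  ∑ t ∈ Finset.Icc 1 T, boolSign (ε (A.block (SimpleGraph.cycleGraph n) P D t))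

lemma regret_blockLoss_ge {R : ℝ} (hR : 0 ≤ R) (A : DOCOAlgorithm.{u, v} n d (cube d R) T C)
    (P : Matrix (Fin n) (Fin n) ℝ) (hd : 0 < d) (G : ℝ) (D : ℕ)
    (ε : Fin (C / D + 1) → Bool) (i : Fin n) :
    ∑ t ∈ Finset.Icc 1 T, boolSign (ε (A.block (SimpleGraph.cycleGraph n) P D t)) *
      ((farVertices n D).card * (G / √d *
        ∑ k, A.decision (SimpleGraph.cycleGraph n) P (A.blockLoss P G D ε) i t k)) +
      (farVertices n D).card * R * G * |A.signedRounds P D ε| ≤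
    A.regret (SimpleGraph.cycleGraph n) P (A.blockLoss P G D ε) i := by
  have hd' : (0 : ℝ) < √d := by positivity
  have hdd : √(d : ℝ) * √d = d := Real.mul_self_sqrt (Nat.cast_nonneg d)
  simp only [regret, sum_blockLoss]
  rw [sub_eq_add_neg]
  refine add_le_add_right ?_ _
  rw [le_neg]
  set c : ℝ := (farVertices n D).card * (G / √d)
  set X := A.signedRounds P D ε with hX
  have hval : ∀ x : EuclideanSpace ℝ (Fin d), ∑ t ∈ Finset.Icc 1 T,
      boolSign (ε (A.block (SimpleGraph.cycleGraph n) P D t)) *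
        ((farVertices n D).card * (G / √d * ∑ k, x k)) = X * c * ∑ k, x k := by
    intro x
    rw [← Finset.sum_mul]
    simp only [hX, signedRounds, c]
    ring
  have hr : 0 ≤ R / √d := by positivity
  have hbdd : BddBelow ((fun x : EuclideanSpace ℝ (Fin d) => ∑ t ∈ Finset.Icc 1 T,
      boolSign (ε (A.block (SimpleGraph.cycleGraph n) P D t)) *
        ((farVertices n D).card * (G / √d * ∑ k, x k))) '' cube d R) := by
    refine ⟨-(|X * c| * (d * (R / √d))), ?_⟩
    rintro _ ⟨x, hx, rfl⟩
    simp only [hval]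
    have h1 : |∑ k, x k| ≤ d * (R / √d) := by
      refine (Finset.abs_sum_le_sum_abs _ _).trans ?_
      refine (Finset.sum_le_sum fun k _ => abs_le.2 (hx k)).trans ?_
      simp
    refine (neg_le_neg ?_).trans (neg_abs_le _)
    rw [abs_mul]
    gcongr
  -- For `s = 1` and `s = -1` these are the opposite corners at which the total loss is extremal.
  have hmem : ∀ s : ℝ, |s| ≤ 1 → WithLp.toLp 2 (fun _ => s * (R / √d)) ∈ cube d R := by
    intro s hs k
    change s * (R / √d) ∈ _
    have := abs_le.1 hs
    exact ⟨by nlinarith, by nlinarith⟩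
  have hsum : ∀ s : ℝ, ∑ k, (WithLp.toLp 2 (fun _ => s * (R / √d)) : EuclideanSpace ℝ (Fin d)) k =
      d * (s * (R / √d)) := fun s => by simp
  have hc : c * (d * (R / √d)) = (farVertices n D).card * R * G := by
    calc c * (d * (R / √d)) = (farVertices n D).card * R * G * (d / (√d * √d)) := by
          simp only [c]
          field_simp
      _ = (farVertices n D).card * R * G := by rw [hdd, div_self (by positivity), mul_one]
  rcases le_total 0 X with h | h
  · refine (csInf_le hbdd ⟨_, hmem (-1) (by simp), rfl⟩).trans (le_of_eq ?_)
    refine (hval _).trans ?_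
    rw [hsum, abs_of_nonneg h, ← hc]
    ring
  · refine (csInf_le hbdd ⟨_, hmem 1 (by simp), rfl⟩).trans (le_of_eq ?_)
    refine (hval _).trans ?_
    rw [hsum, abs_of_nonpos h, ← hc]
    ring

/-- Averaging over the signs of the blocks, the decisions of the vertex `0` do not contribute. -/
lemma exists_blockLoss_regret_ge {R : ℝ} (hR : 0 ≤ R) (A : DOCOAlgorithm.{u, v} n d (cube d R) T C)
    (P : Matrix (Fin n) (Fin n) ℝ) (hd : 0 < d) (G : ℝ) {D : ℕ} (hD : 0 < D)
    (i : Fin n) (hi : cycleLevel i = 0) {B : ℝ}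
    (hB : 2 ^ (C / D + 1) * B ≤ ∑ ε, (farVertices n D).card * R * G * |A.signedRounds P D ε|) :
    ∃ ε, B ≤ A.regret (SimpleGraph.cycleGraph n) P (A.blockLoss P G D ε) i := by
  have h0 : ∑ ε : Fin (C / D + 1) → Bool, ∑ t ∈ Finset.Icc 1 T,
      boolSign (ε (A.block (SimpleGraph.cycleGraph n) P D t)) *
        ((farVertices n D).card * (G / √d *
          ∑ k, A.decision (SimpleGraph.cycleGraph n) P (A.blockLoss P G D ε) i t k)) = 0 := by
    rw [Finset.sum_comm]
    refine Finset.sum_eq_zero fun t _ => ?_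
    refine sum_boolSign_mul_eq_zero _ (fun ε => (farVertices n D).card * (G / √d *
          ∑ k, A.decision (SimpleGraph.cycleGraph n) P (A.blockLoss P G D ε) i t k)) ?_
    intro ε b
    simp only [A.decision_blockLoss_update P G hD ε i hi t b]
  have h1 := Finset.sum_le_sum fun ε (_ : ε ∈ (Finset.univ : Finset (Fin (C / D + 1) → Bool))) =>
    A.regret_blockLoss_ge hR P hd G D ε i
  rw [Finset.sum_add_distrib, h0, zero_add] at h1
  have h2 : ∑ _ε : Fin (C / D + 1) → Bool, B ≤
      ∑ ε, A.regret (SimpleGraph.cycleGraph n) P (A.blockLoss P G D ε) i := by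
    refine le_trans (le_of_eq ?_) (hB.trans h1)
    simp
  obtain ⟨ε, -, hε⟩ := Finset.exists_le_of_sum_le Finset.univ_nonempty h2
  exact ⟨ε, hε⟩

/-- Grouping rounds by block gives a Rademacher sum whose coefficients, the block lengths, add up to
`T`. -/
lemma sum_abs_signedRounds_ge (A : DOCOAlgorithm.{u, v} n d K T C)
    (P : Matrix (Fin n) (Fin n) ℝ) (D : ℕ) :
    2 ^ (C / D + 1) * ((T : ℝ) / √(3 * (C / D + 1 : ℕ))) ≤ ∑ ε, |A.signedRounds P D ε| := by
  set β := A.block (SimpleGraph.cycleGraph n) P D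
  have h := sum_abs_rademacher_ge (Nat.succ_pos (C / D))
    fun z => (((Finset.Icc 1 T).filter fun t => β t = z).card : ℝ)
  have h1 : ∑ z, (((Finset.Icc 1 T).filter fun t => β t = z).card : ℝ) = T := by
    rw [← Nat.cast_sum, ← Finset.card_eq_sum_card_fiberwise fun t _ => Finset.mem_univ (β t)]
    simp
  rw [h1, Nat.abs_cast] at h
  refine h.trans (le_of_eq (Finset.sum_congr rfl fun ε _ => ?_))
  rw [signedRounds, ← Finset.sum_fiberwise_of_maps_to (fun t _ => Finset.mem_univ (β t))]
  congr 1
  refine Finset.sum_congr rfl fun z _ => ?_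
  rw [Finset.sum_congr rfl fun t ht => congrArg (fun w => boolSign (ε w))
    (Finset.mem_filter.1 ht).2, Finset.sum_const, nsmul_eq_mul, mul_comm]

lemma abs_signedRounds_of_lt (A : DOCOAlgorithm.{u, v} n d K T C)
    (P : Matrix (Fin n) (Fin n) ℝ) {D : ℕ} (hCD : C < D) (ε : Fin (C / D + 1) → Bool) :
    |A.signedRounds P D ε| = T := by
  have h : ∀ z : Fin (C / D + 1), z = 0 := by
    intro z
    have := z.isLt
    have h0 := Nat.div_eq_of_lt hCD
    apply Fin.ext
    rw [Fin.val_zero]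
    omega
  simp only [signedRounds, h, Finset.sum_const, Nat.card_Icc, nsmul_eq_mul, abs_mul, abs_boolSign]
  simp

end DOCOAlgorithm

/-! ### Numerical estimates and conclusion -/

/-- Here `r` stands for the fourth root of the gap. Since `(n + 2) ^ 2 ≥ n ^ 2 + 2`, the bound holds
with `√6`, and `12 / 5` is a rational number just below. -/
lemma pow_two_of_cycle_gap {n : ℕ} {r : ℝ} (hr : 0 < r)
    (hρ : 6 / ((n : ℝ) ^ 2 + 2) ≤ r ^ 4) : 12 / 5 ≤ r ^ 2 * (n + 2) := by
  rw [div_le_iff₀ (by positivity)] at hρ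
  have hn : (0 : ℝ) ≤ n := Nat.cast_nonneg n
  have h1 : (0 : ℝ) ≤ r ^ 4 * (4 * n + 2) := by positivity
  refine abs_le_of_sq_le_sq' ?_ (by positivity) |>.2
  nlinarith

/-- The count of far vertices weighed against the radius of the near part of the cycle. -/
lemma cube_le_sq_mul_radius {n m : ℕ} (hn : n = 2 * (m + 1)) :
    (n : ℝ) ^ 2 * (n + 2) ≤
      16 * ((n + 1 - 2 * ((m + 2) / 2) : ℕ) : ℝ) ^ 2 * ((m + 2) / 2 : ℕ) := by
  -- For even `m` this is an equality, which fixes the constant `16`.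
  rcases Nat.even_or_odd' m with ⟨k, rfl | rfl⟩
  · rw [show (2 * k + 2) / 2 = k + 1 by omega, show n + 1 - 2 * (k + 1) = 2 * k + 1 by omega, hn]
    push_cast
    nlinarith
  · rw [show (2 * k + 1 + 2) / 2 = k + 1 by omega,
      show n + 1 - 2 * (k + 1) = 2 * k + 3 by omega, hn]
    push_cast
    have : (0 : ℝ) ≤ k := Nat.cast_nonneg k
    nlinarith [mul_nonneg this this]

lemma rate_le_of_few_blocks {n C D S Z : ℕ} {r : ℝ} (hr : 0 < r) (hD : 0 < D) (hZ : 0 < Z)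
    (hρ : 12 / 5 ≤ r ^ 2 * (n + 2)) (hS : (n : ℝ) ^ 2 * (n + 2) ≤ 16 * (S : ℝ) ^ 2 * D)
    (hZD : Z * D ≤ 4 * (C + 1)) :
    n * √Real.pi / (16 * r * √((C : ℝ) + 1)) ≤ S / √(3 * Z) := by
  have hZ' : (0 : ℝ) < Z := by exact_mod_cast hZ
  have hD' : (0 : ℝ) < D := by exact_mod_cast hD
  have hZD' : (Z : ℝ) * D ≤ 4 * (C + 1) := by exact_mod_cast hZD
  rw [div_le_div_iff₀ (by positivity) (by positivity)]
  refine le_of_sq_le_sq ?_ (by positivity)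
  simp only [mul_pow]
  rw [Real.sq_sqrt Real.pi_pos.le, Real.sq_sqrt (by positivity), Real.sq_sqrt (by positivity)]
  refine le_of_mul_le_mul_right ?_ hD'
  calc (n : ℝ) ^ 2 * Real.pi * (3 * Z) * D = 3 * Real.pi * n ^ 2 * (Z * D) := by ring
    _ ≤ 3 * 3.15 * (n : ℝ) ^ 2 * (4 * (C + 1)) := by gcongr; exact Real.pi_lt_d2.le
    _ ≤ 16 * (12 / 5) * (n : ℝ) ^ 2 * (C + 1) := by
        have : (0 : ℝ) ≤ (n : ℝ) ^ 2 * (C + 1) := by positivity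
        nlinarith
    _ ≤ 16 * (r ^ 2 * (n + 2)) * n ^ 2 * (C + 1) := by gcongr
    _ = 16 * r ^ 2 * (C + 1) * (n ^ 2 * (n + 2)) := by ring
    _ ≤ 16 * r ^ 2 * (C + 1) * (16 * S ^ 2 * D) := by gcongr
    _ = S ^ 2 * (16 ^ 2 * r ^ 2 * (C + 1)) * D := by ring

lemma sqrt_pi_le_of_cycle_gap {n T : ℕ} {r : ℝ} (hr : 0 < r) (hn : 4 ≤ n) (hT : n ≤ 8 * T)
    (hρ : 12 / 5 ≤ r ^ 2 * (n + 2)) : √Real.pi ≤ 4 * r * √(T : ℝ) := by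
  refine le_of_sq_le_sq ?_ (by positivity)
  rw [mul_pow, Real.sq_sqrt Real.pi_pos.le, Real.sq_sqrt (Nat.cast_nonneg T)]
  have h1 : (n : ℝ) + 2 ≤ 12 * T := by exact_mod_cast (by omega : n + 2 ≤ 12 * T)
  have h2 := mul_le_mul_of_nonneg_left h1 (sq_nonneg r)
  have := Real.pi_lt_d2
  nlinarith

theorem theorem2 (n m : ℕ) (hm : 0 < m) (hn : n = 2 * (m + 1)) (d : ℕ) (hd : 0 < d)
    (R G : ℝ) (hR : 0 ≤ R) (hG : 0 ≤ G) (T C : ℕ)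
    (A : DOCOAlgorithm.{u, v} n d (cube d R) T C) :
    ∃ (f : ℕ → Fin n → EuclideanSpace ℝ (Fin d) → ℝ) (Γ : SimpleGraph (Fin n))
      (P : Matrix (Fin n) (Fin n) ℝ),
      -- the losses are linear, and `G`-Lipschitz over the decision set
      (∀ t ∈ Finset.Icc 1 T, ∀ i, IsLinearMap ℝ (f t i) ∧
        ∀ x ∈ cube d R, ∀ y ∈ cube d R, |f t i x - f t i y| ≤ G * ‖x - y‖) ∧
      Γ = SimpleGraph.cycleGraph n ∧
      IsCommunicationMatrix Γ P ∧
      -- the lower bounds on the regret of learner 1 (the vertex `0` of the cycle)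
      (n ≤ 8 * C + 16 →
        (n : ℝ) * √Real.pi * R * G * T /
            (16 * (1 - sigmaTwo P) ^ (1 / 4 : ℝ) * √((C : ℝ) + 1)) ≤
          A.regret Γ P f ⟨0, by omega⟩) ∧
      (8 * C + 16 < n → (n : ℝ) * R * G * T / 4 ≤ A.regret Γ P f ⟨0, by omega⟩) ∧
      -- the resulting bound of order `n ρ^(-1/4) √T`, whatever the number of communication rounds
      (n ≤ 8 * T →
        (n : ℝ) * √Real.pi * R * G * √(T : ℝ) / (16 * (1 - sigmaTwo P) ^ (1 / 4 : ℝ)) ≤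
          A.regret Γ P f ⟨0, by omega⟩) := by
  have : NeZero n := ⟨by omega⟩
  set P := lazyCycleMatrix n with hP
  set D := (m + 2) / 2 with hDdef
  set S := n + 1 - 2 * D with hSdef
  have hD : 0 < D := by omega
  have hcard : (farVertices n D).card = S := card_farVertices hD (by omega)
  have hcomm := isCommunicationMatrix_lazyCycleMatrix hn (by omega : 2 ≤ m + 1)
  have hσ := sigmaTwo_lazyCycleMatrix_le hn (by omega : 2 ≤ m + 1)
  rw [← hP] at hcomm hσ
  have hρ : 0 < 1 - sigmaTwo P := sub_pos.2 hcomm.sigmaTwo_lt_one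
  set r := (1 - sigmaTwo P) ^ (1 / 4 : ℝ) with hr
  have hr0 : 0 < r := Real.rpow_pos_of_pos hρ _
  have hr4 : r ^ 4 = 1 - sigmaTwo P := by
    rw [hr, ← Real.rpow_natCast, ← Real.rpow_mul hρ.le]
    norm_num
  have hgap : 12 / 5 ≤ r ^ 2 * (n + 2) := pow_two_of_cycle_gap hr0 (by rw [hr4]; linarith)
  have hlev : cycleLevel (⟨0, by omega⟩ : Fin n) = 0 := Nat.zero_min _
  have hRG : 0 ≤ R * G := mul_nonneg hR hG
  have hlip : ∀ ε, ∀ t ∈ Finset.Icc 1 T, ∀ i, IsLinearMap ℝ (A.blockLoss P G D ε t i) ∧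
      ∀ x ∈ cube d R, ∀ y ∈ cube d R,
        |A.blockLoss P G D ε t i x - A.blockLoss P G D ε t i y| ≤ G * ‖x - y‖ := fun ε t _ i =>
    ⟨A.isLinearMap_blockLoss P G D ε t i, fun x _ y _ => A.blockLoss_lipschitz P hd hG D ε t i x y⟩
  by_cases hC : n ≤ 8 * C + 16
  · obtain ⟨ε, hε⟩ := A.exists_blockLoss_regret_ge hR P hd G hD ⟨0, by omega⟩ hlev
      (B := S * R * G * ((T : ℝ) / √(3 * (C / D + 1 : ℕ)))) (by
        rw [hcard, ← Finset.mul_sum, mul_left_comm]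
        exact mul_le_mul_of_nonneg_left (A.sum_abs_signedRounds_ge P D) (by positivity))
    -- The product is at most `C + D`, and `n ≤ 8 * C + 16` forces `D ≤ 2 * C + 4`.
    have hblocks : (C / D + 1) * D ≤ 4 * (C + 1) := by
      have := Nat.div_mul_le_self C D
      rw [add_mul]
      omega
    have hrate := rate_le_of_few_blocks hr0 hD (Nat.succ_pos (C / D)) hgap
      (cube_le_sq_mul_radius hn) hblocks
    have hmain : (n : ℝ) * √Real.pi * R * G * T / (16 * r * √((C : ℝ) + 1)) ≤
        A.regret (SimpleGraph.cycleGraph n) P (A.blockLoss P G D ε) ⟨0, by omega⟩ := by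
      refine le_trans ?_ hε
      have := mul_le_mul_of_nonneg_right hrate (mul_nonneg hRG (Nat.cast_nonneg T))
      refine (le_of_eq ?_).trans (this.trans (le_of_eq ?_)) <;> ring
    refine ⟨A.blockLoss P G D ε, _, P, hlip ε, rfl, hcomm, fun _ => hmain,
      fun h => absurd h (by omega), fun hT => le_trans ?_ hmain⟩
    -- No communication takes place in round `T`, and `n ≤ 8 * T` excludes `T = 0`.
    have hCT : C + 1 ≤ T := by
      have := Finset.card_le_card (A.commRounds_subset (SimpleGraph.cycleGraph n) P)
      rw [A.card_commRounds, Nat.card_Ico] at this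
      omega
    have hsqrt : √((C : ℝ) + 1) ≤ √(T : ℝ) := Real.sqrt_le_sqrt (by exact_mod_cast hCT)
    rw [div_le_div_iff₀ (by positivity) (by positivity)]
    calc (n : ℝ) * √Real.pi * R * G * √(T : ℝ) * (16 * r * √((C : ℝ) + 1))
        = (n * √Real.pi * (R * G)) * (16 * r) * (√(T : ℝ) * √((C : ℝ) + 1)) := by ring
      _ ≤ (n * √Real.pi * (R * G)) * (16 * r) * (√(T : ℝ) * √(T : ℝ)) := by gcongr
      _ = n * √Real.pi * R * G * T * (16 * r) := by
        rw [Real.mul_self_sqrt (Nat.cast_nonneg T)]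
        ring
  -- Now `C < D`: one block covers all rounds, so vertex `0` never learns the sign.
  · obtain ⟨ε, hε⟩ := A.exists_blockLoss_regret_ge hR P hd G hD ⟨0, by omega⟩ hlev
      (B := S * R * G * T) (by
        simp only [hcard, A.abs_signedRounds_of_lt P (show C < D by omega)]
        simp)
    have hS : (n : ℝ) / 2 ≤ S := by
      rw [div_le_iff₀ (by norm_num)]
      exact_mod_cast (by omega : n ≤ S * 2)
    have hmain : (n : ℝ) * R * G * T / 4 ≤
        A.regret (SimpleGraph.cycleGraph n) P (A.blockLoss P G D ε) ⟨0, by omega⟩ := by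
      refine le_trans ?_ hε
      have h1 : (n : ℝ) / 4 ≤ S := by
        have := Nat.cast_nonneg (α := ℝ) n
        linarith
      have := mul_le_mul_of_nonneg_right h1 (mul_nonneg hRG (Nat.cast_nonneg T))
      refine (le_of_eq ?_).trans (this.trans (le_of_eq ?_)) <;> ring
    refine ⟨A.blockLoss P G D ε, _, P, hlip ε, rfl, hcomm, fun h => absurd h hC,
      fun _ => hmain, fun hT => le_trans ?_ hmain⟩
    have hpi := sqrt_pi_le_of_cycle_gap hr0 (by omega) hT hgap
    rw [div_le_div_iff₀ (by positivity) (by norm_num)]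
    calc (n : ℝ) * √Real.pi * R * G * √(T : ℝ) * 4
        = n * (R * G) * √(T : ℝ) * 4 * √Real.pi := by ring
      _ ≤ n * (R * G) * √(T : ℝ) * 4 * (4 * r * √(T : ℝ)) := by gcongr
      _ = n * (R * G) * (√(T : ℝ) * √(T : ℝ)) * (16 * r) := by ring
      _ = n * R * G * T * (16 * r) := by
        rw [Real.mul_self_sqrt (Nat.cast_nonneg T)]
        ring
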